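/- Let $\mathcal R=\overline{\bigotimes_{k\ge 1}M_2(\mathbb C)}^{\,\mathrm{WOT}}$ be the hyperfinite $\mathrm{II}_1$-factor, where the algebraic tensor product $\bigotimes_{k\ge1}M_2(\mathbb C)$ (finite linear combinations of elementary tensors with all but finitely many entries equal to $1$) carries the product $\tau$ of the normalized traces and acts by left multiplication on $\mathcal H=L^2\big(\bigotimes_{k\ge1}M_2(\mathbb C),\tau\big)$, its completion for the norm $\|x\|_2=\tau(x^*x)^{1/2}$. Let $V=\begin{pmatrix}0&1\\0&0\end{pmatrix}$ and $V_k=I^{\otimes(k-1)}\otimes V\in\mathcal R$ for $k\ge 1$. Let $(c_k)_{k\ge1}$ be a sequence of complex numbers with $\sum_k|c_k|<\infty$ and $c_k\ne0$ for all $k$, and put $$A_n=\sum_{k=1}^n c_kV_k,\qquad A=\sum_{k=1}^\infty c_kV_k,$$ the series converging in operator norm. An orthogonal projection $p\in\mathcal B(\mathcal H)$ is called $T$-hyperinvariant, for $T\in\mathcal B(\mathcal H)$, if $pSp=Sp$ for every $S\in\mathcal B(\mathcal H)$ with $ST=TS$, and non-trivial if $p\neq0$ and $p\neq1$. Then for every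 $n\in\mathbb N$, no non-trivial $A_n$-hyperinvariant projection $p\in\mathcal R$ is $A$-hyperinvariant. -/

import Mathlib

noncomputable section

namespace HyperfiniteFactor

open scoped Matrix.Norms.L2Operator MatrixOrder

/-! ### The algebraic tensor product of countably many copies of the two-by-two matrices -/

/-- `M₂(ℂ)^{⊗ n}`, written as the matrices whose rows and columns are indexed by words of length
`n` in two letters: the elementary tensor `x₀ ⊗ ⋯ ⊗ xₙ₋₁` is the matrix `tensor x` below. -/
abbrev Mat (n : ℕ) : Type := Matrix (Fin n → Fin 2) (Fin n → Fin 2) ℂ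

/-- The elementary tensor `x₀ ⊗ ⋯ ⊗ xₙ₋₁`. -/
def tensor {n : ℕ} (x : Fin n → Matrix (Fin 2) (Fin 2) ℂ) : Mat n :=
  Matrix.of fun s t => ∏ k, x k (s k) (t k)

theorem tensor_mul {n : ℕ} (x y : Fin n → Matrix (Fin 2) (Fin 2) ℂ) :
    tensor x * tensor y = tensor (x * y) := by
  ext s t
  simp only [tensor, Matrix.mul_apply, Matrix.of_apply, Pi.mul_apply, ← Finset.prod_mul_distrib]
  rw [Finset.prod_univ_sum, Fintype.piFinset_univ]

theorem tensor_star {n : ℕ} (x : Fin n → Matrix (Fin 2) (Fin 2) ℂ) :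
    star (tensor x) = tensor (star x) := by
  ext s t
  simp [tensor, Matrix.star_apply]

theorem tensor_one {n : ℕ} : tensor (1 : Fin n → Matrix (Fin 2) (Fin 2) ℂ) = 1 := by
  ext s t
  simp only [tensor, Matrix.of_apply, Pi.one_apply, Matrix.one_apply, Fintype.prod_ite_zero,
    Finset.prod_const_one, funext_iff]

/-- The underlying function of the inclusion `a ↦ a ⊗ 1 ⊗ ⋯ ⊗ 1`. -/
def embFun {m n : ℕ} (h : m ≤ n) (a : Mat m) : Mat n :=
  Matrix.of fun s t =>
    if ∀ k : Fin n, m ≤ (k : ℕ) → s k = t k then a (s ∘ Fin.castLE h) (t ∘ Fin.castLE h) else 0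

theorem embFun_append {m d : ℕ} (a : Mat m) (s t : Fin m → Fin 2) (u v : Fin d → Fin 2) :
    embFun (Nat.le_add_right m d) a (Fin.append s u) (Fin.append t v)
      = if u = v then a s t else 0 := by
  have h1 : ∀ (s : Fin m → Fin 2) (u : Fin d → Fin 2),
      Fin.append s u ∘ Fin.castLE (Nat.le_add_right m d) = s := by
    intro s u
    funext i
    exact Fin.append_left s u i
  have h2 : (∀ k : Fin (m + d), m ≤ (k : ℕ) → Fin.append s u k = Fin.append t v k) ↔ u = v := by
    constructor
    · intro h
      funext i
      simpa using h (Fin.natAdd m i) (by simp)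
    · rintro rfl k hk
      refine Fin.addCases (fun i => ?_) (fun i => ?_) k (motive := fun k =>
        m ≤ (k : ℕ) → Fin.append s u k = Fin.append t u k) hk
      · intro hi
        exact absurd i.2 (by simp at hi; omega)
      · simp
  simp only [embFun, Matrix.of_apply, h1, h2]

theorem mat_ext_append {m d : ℕ} {a b : Mat (m + d)}
    (h : ∀ s u t v, a (Fin.append s u) (Fin.append t v) = b (Fin.append s u) (Fin.append t v)) :
    a = b := by
  ext s t
  obtain ⟨⟨s, u⟩, rfl⟩ := (Fin.appendEquiv m d).surjective s
  obtain ⟨⟨t, v⟩, rfl⟩ := (Fin.appendEquiv m d).surjective t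
  exact h s u t v

theorem sum_append {m d : ℕ} (f : (Fin (m + d) → Fin 2) → ℂ) :
    ∑ s, f s = ∑ s : Fin m → Fin 2, ∑ u : Fin d → Fin 2, f (Fin.append s u) := by
  rw [← Fintype.sum_prod_type', ← (Fin.appendEquiv m d).sum_comp]
  rfl

theorem append_inj {m d : ℕ} (s t : Fin m → Fin 2) (u v : Fin d → Fin 2) :
    Fin.append s u = Fin.append t v ↔ s = t ∧ u = v := by
  rw [← Prod.mk.injEq]
  exact (Fin.appendEquiv m d).injective.eq_iff (a := (s, u)) (b := (t, v))

/-- The inclusion `M₂(ℂ)^{⊗ m} → M₂(ℂ)^{⊗ n}`, `a ↦ a ⊗ 1 ⊗ ⋯ ⊗ 1`. -/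
def emb (m n : ℕ) (h : m ≤ n) : Mat m →⋆ₐ[ℂ] Mat n where
  toFun := embFun h
  map_one' := by
    obtain ⟨d, rfl⟩ := Nat.exists_eq_add_of_le h
    refine mat_ext_append fun s u t v => ?_
    rw [embFun_append]
    simp only [Matrix.one_apply, append_inj]
    grind
  map_mul' a b := by
    obtain ⟨d, rfl⟩ := Nat.exists_eq_add_of_le h
    refine mat_ext_append fun s u t v => ?_
    rw [embFun_append]
    simp only [Matrix.mul_apply, sum_append, embFun_append]
    by_cases huv : u = v
    · simp [huv]
    · simp only [huv, if_false]
      symm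
      refine Finset.sum_eq_zero fun r _ => Finset.sum_eq_zero fun w _ => ?_
      by_cases h1 : u = w
      · subst h1; simp [huv]
      · simp [h1]
  map_zero' := by
    ext s t
    simp [embFun]
  map_add' a b := by
    ext s t
    simp only [embFun, Matrix.of_apply, Matrix.add_apply]
    split_ifs <;> simp
  commutes' r := by
    obtain ⟨d, rfl⟩ := Nat.exists_eq_add_of_le h
    refine mat_ext_append fun s u t v => ?_
    rw [embFun_append]
    simp only [Matrix.algebraMap_matrix_apply, append_inj]
    grind
  map_star' a := by
    ext s t
    simp only [embFun, Matrix.of_apply, Matrix.star_apply, eq_comm (a := s _)]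
    split_ifs <;> simp

theorem emb_append {m d : ℕ} (a : Mat m) (s t : Fin m → Fin 2) (u v : Fin d → Fin 2) :
    emb m (m + d) (Nat.le_add_right m d) a (Fin.append s u) (Fin.append t v)
      = if u = v then a s t else 0 :=
  embFun_append a s t u v

instance : DirectedSystem Mat (emb · · ·) where
  map_self n a := by
    ext s t
    change embFun le_rfl a s t = a s t
    simp only [embFun, Matrix.of_apply]
    rw [if_pos fun k hk => absurd k.2 (by omega)]
    rfl
  map_map l n m h h' a := by
    ext s t
    change embFun h' (embFun h a) s t = embFun (h.trans h') a s t
    simp only [embFun, Matrix.of_apply]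
    by_cases h1 : ∀ k : Fin l, m ≤ (k : ℕ) → s k = t k
    · rw [if_pos h1, if_pos fun k hk => h1 k (h.trans hk)]
      exact if_pos fun (k : Fin n) hk => h1 (Fin.castLE h' k) hk
    · rw [if_neg h1]
      by_cases h2 : ∀ k : Fin l, n ≤ (k : ℕ) → s k = t k
      · rw [if_pos h2, if_neg]
        intro h3
        refine h1 fun k hk => ?_
        by_cases hkn : (k : ℕ) < n
        · exact h3 ⟨k, hkn⟩ hk
        · exact h2 k (by omega)
      · rw [if_neg h2]

/-- The algebraic infinite tensor product `⨂ M₂(ℂ)`: finite linear combinations of elementary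
tensors almost all of whose entries are `1`, that is, the union of the `M₂(ℂ)^{⊗ n}` along the
inclusions `a ↦ a ⊗ 1`. -/
def AlgTensor : Type := DirectLimit Mat emb

namespace AlgTensor

instance : Ring AlgTensor := inferInstanceAs (Ring (DirectLimit Mat emb))
instance : Algebra ℂ AlgTensor := inferInstanceAs (Algebra ℂ (DirectLimit Mat emb))
instance : StarRing AlgTensor := inferInstanceAs (StarRing (DirectLimit Mat emb))
instance : StarModule ℂ AlgTensor := inferInstanceAs (StarModule ℂ (DirectLimit Mat emb))

/-- The canonical map `M₂(ℂ)^{⊗ n} → ⨂ M₂(ℂ)`, `a ↦ a ⊗ 1 ⊗ 1 ⊗ ⋯`. -/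
def of (n : ℕ) : Mat n →ₗ[ℂ] AlgTensor := DirectLimit.Module.of ℂ ℕ Mat emb n

theorem of_mul {n : ℕ} (a b : Mat n) : of n (a * b) = of n a * of n b :=
  (DirectLimit.mul_def (f := emb) n a b).symm

theorem of_star {n : ℕ} (a : Mat n) : of n (star a) = star (of n a) :=
  (DirectLimit.star_def (f := emb) n a).symm

theorem of_one (n : ℕ) : of n 1 = 1 :=
  (DirectLimit.one_def (f := emb) n).symm

theorem exists_of (a : AlgTensor) : ∃ n x, a = of n x :=
  DirectLimit.exists_eq_mk emb a

/-- The product state `τ = ⨂ tr` of the normalized traces; on `M₂(ℂ)^{⊗ n}` it is the normalized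
trace. -/
def trace : AlgTensor →ₗ[ℂ] ℂ :=
  DirectLimit.Module.lift ℂ ℕ Mat emb
    (fun n => ((2 : ℂ) ^ n)⁻¹ • Matrix.traceLinearMap (Fin n → Fin 2) ℂ ℂ) (by
      intro m n h a
      obtain ⟨d, rfl⟩ := Nat.exists_eq_add_of_le h
      simp only [LinearMap.smul_apply, Matrix.traceLinearMap_apply, Matrix.trace,
        Matrix.diag_apply, sum_append, emb_append, smul_eq_mul, if_true, Finset.sum_const,
        Finset.card_univ, Fintype.card_pi, Fintype.card_fin, Finset.prod_const, nsmul_eq_mul,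
        ← Finset.mul_sum, pow_add]
      push_cast
      field_simp)

theorem trace_of {n : ℕ} (a : Mat n) : trace (of n a) = ((2 : ℂ) ^ n)⁻¹ * Matrix.trace a := rfl

theorem trace_tensor {n : ℕ} (x : Fin n → Matrix (Fin 2) (Fin 2) ℂ) :
    trace (of n (tensor x)) = ∏ k, (2 : ℂ)⁻¹ * Matrix.trace (x k) := by
  rw [trace_of, Finset.prod_mul_distrib]
  simp only [Finset.prod_const, Finset.card_univ, Fintype.card_fin, inv_pow]
  congr 1
  simp only [Matrix.trace, Matrix.diag_apply, tensor, Matrix.of_apply]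
  rw [Finset.prod_univ_sum, Fintype.piFinset_univ]

theorem trace_star (a : AlgTensor) : trace (star a) = star (trace a) := by
  obtain ⟨n, a, rfl⟩ := exists_of a
  rw [← of_star, trace_of, trace_of, Matrix.star_eq_conjTranspose, Matrix.trace_conjTranspose]
  simp

theorem trace_star_mul_self_of {n : ℕ} (a : Mat n) :
    trace (star (of n a) * of n a) = (((2 : ℝ) ^ n)⁻¹ * ∑ s, ∑ t, ‖a t s‖ ^ 2 : ℝ) := by
  rw [← of_star, ← of_mul, trace_of]
  simp [Matrix.trace, Matrix.mul_apply, Matrix.star_apply, Complex.conj_mul']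

theorem trace_star_mul_self_nonneg (a : AlgTensor) : 0 ≤ (trace (star a * a)).re := by
  obtain ⟨n, a, rfl⟩ := exists_of a
  rw [trace_star_mul_self_of, Complex.ofReal_re]
  positivity

theorem eq_zero_of_trace (a : AlgTensor) (h : trace (star a * a) = 0) : a = 0 := by
  obtain ⟨n, a, rfl⟩ := exists_of a
  rw [trace_star_mul_self_of, Complex.ofReal_eq_zero] at h
  have h2 : ∑ s, ∑ t, ‖a t s‖ ^ 2 = 0 := by
    rcases mul_eq_zero.1 h with h | h
    · exact absurd h (by positivity)
    · exact h
  have h3 : a = 0 := by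
    ext t s
    rw [Finset.sum_eq_zero_iff_of_nonneg fun _ _ => by positivity] at h2
    have h4 := h2 s (Finset.mem_univ s)
    rw [Finset.sum_eq_zero_iff_of_nonneg fun _ _ => by positivity] at h4
    simpa using h4 t (Finset.mem_univ t)
  rw [h3, map_zero]

/-! ### The Hilbert space `L²(R)` and the representation by left multiplication -/

/-- The inner product `⟪a, b⟫ = τ(a* b)`, so that `‖a‖ = ‖a‖₂ = τ(a* a)^{1/2}`. -/
@[reducible] def innerCore : InnerProductSpace.Core ℂ AlgTensor where
  inner a b := trace (star a * b)
  conj_inner_symm a b := by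
    change star (trace (star b * a)) = _
    rw [← trace_star]
    simp
  re_inner_nonneg a := trace_star_mul_self_nonneg a
  add_left a b d := by simp [add_mul]
  smul_left a b r := by simp
  definite a h := eq_zero_of_trace a h

instance : NormedAddCommGroup AlgTensor := innerCore.toNormedAddCommGroup
instance : InnerProductSpace ℂ AlgTensor := InnerProductSpace.ofCore innerCore.toCore

theorem inner_def (a b : AlgTensor) : inner ℂ a b = trace (star a * b) := rfl

theorem norm_sq_eq (a : AlgTensor) : ‖a‖ ^ 2 = (trace (star a * a)).re := by
  rw [← inner_def, norm_sq_eq_re_inner (𝕜 := ℂ)]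
  rfl

theorem norm_mul_le_of {a d : AlgTensor} {r : ℝ} (hr : 0 ≤ r)
    (h : star a * a + star d * d = ((r ^ 2 : ℝ) : ℂ) • 1) (b : AlgTensor) :
    ‖a * b‖ ≤ r * ‖b‖ := by
  have h1 : ‖a * b‖ ^ 2 + ‖d * b‖ ^ 2 = r ^ 2 * ‖b‖ ^ 2 := by
    simp only [norm_sq_eq, star_mul]
    rw [← Complex.add_re, ← map_add]
    have h2 : star b * star a * (a * b) + star b * star d * (d * b)
        = ((r ^ 2 : ℝ) : ℂ) • (star b * b) := by
      calc _ = star b * (star a * a + star d * d) * b := by noncomm_ring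
        _ = _ := by rw [h]; simp
    rw [h2, map_smul, smul_eq_mul, Complex.re_ofReal_mul]
  refine le_of_sq_le_sq ?_ (by positivity)
  rw [mul_pow]
  nlinarith [sq_nonneg ‖d * b‖]

theorem exists_norm_mul_le (a : AlgTensor) : ∃ C, ∀ b : AlgTensor, ‖a * b‖ ≤ C * ‖b‖ := by
  obtain ⟨n, M, rfl⟩ := exists_of a
  have h1 : ∃ N : Mat n, algebraMap ℝ (Mat n) (‖M‖ ^ 2) - star M * M = star N * N := by
    have h2 : star M * M ≤ algebraMap ℝ (Mat n) (‖M‖ ^ 2) := by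
      have h3 := IsSelfAdjoint.le_algebraMap_norm_self (a := star M * M) (.star_mul_self M)
      rwa [CStarRing.norm_star_mul_self, ← sq] at h3
    exact CStarAlgebra.nonneg_iff_eq_star_mul_self.1 (sub_nonneg.2 h2)
  obtain ⟨N, hN⟩ := h1
  refine ⟨‖M‖, norm_mul_le_of (d := of n N) (norm_nonneg _) ?_⟩
  rw [← of_star, ← of_star, ← of_mul, ← of_mul, ← map_add, ← hN, add_sub_cancel, ← of_one n,
    ← map_smul]
  congr 1
  rw [Algebra.algebraMap_eq_smul_one, Complex.coe_smul]

/-- Left multiplication by `a` as a bounded operator for the norm `‖·‖₂`. -/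
def lmul (a : AlgTensor) : AlgTensor →L[ℂ] AlgTensor :=
  (LinearMap.mulLeft ℂ a).mkContinuousOfExistsBound
    (exists_norm_mul_le a)

end AlgTensor

/-- The Hilbert space `L²(⨂ M₂(ℂ), τ)`. -/
abbrev LTwo : Type := UniformSpace.Completion AlgTensor

/-- The representation `π` of `⨂ M₂(ℂ)` on `L²` by left multiplication. -/
def leftRep (a : AlgTensor) : LTwo →L[ℂ] LTwo := (AlgTensor.lmul a).completion

theorem leftRep_coe (a b : AlgTensor) : leftRep a (b : LTwo) = ((a * b : AlgTensor) : LTwo) :=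
  ContinuousLinearMap.completion_apply_coe _ _

/-- The hyperfinite factor `R`: the closure of the image of `π` in the weak operator topology. -/
def hyperfinite : Set (LTwo →L[ℂ] LTwo) :=
  {T | ContinuousLinearMapWOT.ofCLM T ∈
    closure (Set.range fun a => ContinuousLinearMapWOT.ofCLM (leftRep a))}

/-! ### The operators -/

/-- The matrix unit `V`. -/
def V : Matrix (Fin 2) (Fin 2) ℂ := !![0, 1; 0, 0]

/-- `I^{⊗ k} ⊗ V` as an operator in `R`; the tensor factors are numbered from `0`. -/
def Vop (k : ℕ) : LTwo →L[ℂ] LTwo :=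
  leftRep (AlgTensor.of (k + 1) (tensor (Fin.snoc (fun _ : Fin k => 1) V)))

theorem norm_Vop_le (k : ℕ) : ‖Vop k‖ ≤ 1 := by
  have hV : star V * V + star (!![1, 0; 0, 0] : Matrix (Fin 2) (Fin 2) ℂ) * !![1, 0; 0, 0] = 1 := by
    ext i j
    fin_cases i <;> fin_cases j <;> simp [V, Matrix.mul_apply, Fin.sum_univ_two]
  have hb : ∀ b : AlgTensor,
      ‖AlgTensor.of (k + 1) (tensor (Fin.snoc (fun _ : Fin k => 1) V)) * b‖ ≤ 1 * ‖b‖ := by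
    refine AlgTensor.norm_mul_le_of
      (d := AlgTensor.of (k + 1) (tensor (Fin.snoc (fun _ : Fin k => 1) !![1, 0; 0, 0])))
      zero_le_one ?_
    rw [← AlgTensor.of_star, ← AlgTensor.of_star, ← AlgTensor.of_mul, ← AlgTensor.of_mul,
      ← map_add, tensor_star, tensor_star, tensor_mul, tensor_mul]
    simp only [one_pow, Complex.ofReal_one, one_smul, ← AlgTensor.of_one (k + 1), ← tensor_one]
    congr 1
    ext s t
    simp only [tensor, Matrix.of_apply, Matrix.add_apply, Fin.prod_univ_castSucc, Pi.mul_apply,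
      Pi.star_apply, Fin.snoc_castSucc, Fin.snoc_last, star_one, mul_one, Pi.one_apply, ← mul_add]
    rw [← Matrix.add_apply, hV]
  refine ContinuousLinearMap.opNorm_le_bound _ zero_le_one fun x => ?_
  induction x using UniformSpace.Completion.induction_on with
  | hp => exact isClosed_le (by fun_prop) (by fun_prop)
  | ih b =>
    rw [Vop, leftRep_coe, UniformSpace.Completion.norm_coe, UniformSpace.Completion.norm_coe]
    exact hb b

/-- `Aₙ = c₀ V₀ + ⋯ + cₙ₋₁ Vₙ₋₁`. -/
def partialOp (c : ℕ → ℂ) (n : ℕ) : LTwo →L[ℂ] LTwo := ∑ k ∈ Finset.range n, c k • Vop k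

/-- `A = ∑ cₖ Vₖ`, a series in operator norm. -/
def fullOp (c : ℕ → ℂ) : LTwo →L[ℂ] LTwo := ∑' k, c k • Vop k

theorem summable_smul_Vop {c : ℕ → ℂ} (hc : Summable fun k => ‖c k‖) :
    Summable fun k => c k • Vop k :=
  .of_norm_bounded hc fun k => (norm_smul_le _ _).trans
    (mul_le_of_le_one_right (norm_nonneg _) (norm_Vop_le k))

/-- The subspace `p H` is `T`-hyperinvariant: it is invariant, `p S p = S p`, under every bounded
operator `S` that commutes with `T`. -/
def IsHyperinvariant {H : Type*} [NormedAddCommGroup H] [InnerProductSpace ℂ H]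
    (p T : H →L[ℂ] H) : Prop :=
  ∀ S : H →L[ℂ] H, Commute S T → p * S * p = S * p

end HyperfiniteFactor

end

/-!
Write `e^k_ab` for the matrix units of the tensor factor number `k`, acting on `L²` by left
multiplication, so that `Vₖ = e^k_01`. Let `p` be hyperinvariant for both `Aₙ` and `A`.

For `k ≥ n` the self-adjoint family `e^k_ab` commutes with `Aₙ`, which involves only the factors
below `n`; hence `p` commutes with it (`commute_of_mul_mul_eq`). For `i < n` the operator `A` commutes
with a weighted flip of the factors `i` and `n`,
`F = cᵢcₙ (e^i_00 e^n_00 + e^i_11 e^n_11) + cᵢ² e^i_01 e^n_10 + cₙ² e^i_10 e^n_01`: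
up to a scalar, it is the ordinary flip conjugated by `diag (cᵢ / cₙ, 1)` in the factor `i`, and the
same conjugation turns `Vᵢ + Vₙ`, which commutes with the ordinary flip, into a multiple of
`cᵢ Vᵢ + cₙ Vₙ` (`weightedFlip_commute`, `weightedFlip_commute_fullOp`).
The range of `p` is invariant under `F`, and `p` commutes with the `e^n_ab`. Compressing `F` by the
`e^n_ab` yields nonzero multiples of the `e^i_ab`, because `cᵢ` and `cₙ` do not vanish, so the range
of `p` is invariant under the `e^i_ab` too (`mul_mul_eq_of_weightedFlip`), and `p` commutes with them.

Thus `p` commutes with all matrix units, hence with `⨂ M₂(ℂ)`. As `p` lies in `R` and `R` is a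
factor (`exists_eq_smul_one`, by uniqueness of the trace on `M₂(ℂ)^{⊗ n}`), the projection `p` is
a scalar, so it is `0` or `1`.
-/

namespace HyperfiniteFactor

open scoped InnerProductSpace

/-! ### Systems of matrix units and the weighted flip -/

/-- A system of two-by-two matrix units in a star ring `B`: `e a b` plays the role of the matrix
with a single entry `1` in position `(a, b)`. -/
structure IsMatrixUnits {B : Type*} [Ring B] [Star B] (e : Fin 2 → Fin 2 → B) : Prop where
  mul_eq : ∀ a b c d, e a b * e c d = if b = c then e a d else 0
  sum_diag : ∑ a, e a a = 1
  star_eq : ∀ a b, star (e a b) = e b a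

section Flip

variable {B : Type*} [Ring B] [Star B] [Algebra ℂ B] {e f : Fin 2 → Fin 2 → B}

/-- The weighted flip of two commuting systems of matrix units: up to the scalar `x * y`, the flip
`∑ e a b * f b a` conjugated by `diag (x / y, 1)` in the first factor. -/
def weightedFlip (e f : Fin 2 → Fin 2 → B) (x y : ℂ) : B :=
  (x * y) • (e 0 0 * f 0 0) + (x * y) • (e 1 1 * f 1 1) + x ^ 2 • (e 0 1 * f 1 0)
    + y ^ 2 • (e 1 0 * f 0 1)

theorem weightedFlip_commute (he : IsMatrixUnits e) (hf : IsMatrixUnits f)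
    (hef : ∀ a b c d, Commute (e a b) (f c d)) (x y : ℂ) :
    Commute (weightedFlip e f x y) (x • e 0 1 + y • f 0 1) := by
  have h1 : ∀ a b c d, f a b * e c d = e c d * f a b := fun a b c d => (hef c d a b).eq.symm
  have h2 : ∀ a b c d z, f a b * (e c d * z) = e c d * (f a b * z) := fun a b c d z => by
    rw [← mul_assoc, h1, mul_assoc]
  have h3 : ∀ a b c d z, e a b * (e c d * z) = if b = c then e a d * z else 0 :=
    fun a b c d z => by
      rw [← mul_assoc, he.mul_eq]
      split_ifs <;> simp
  have hse := he.sum_diag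
  have hsf := hf.sum_diag
  rw [Fin.sum_univ_two] at hse hsf
  have h4 : e 0 1 = e 0 1 * f 0 0 + e 0 1 * f 1 1 := by rw [← mul_add, hsf, mul_one]
  have h5 : f 0 1 = e 0 0 * f 0 1 + e 1 1 * f 0 1 := by rw [← add_mul, hse, one_mul]
  rw [h4, h5, commute_iff_eq]
  simp only [weightedFlip, mul_add, add_mul, smul_mul_assoc, mul_smul_comm, mul_assoc, h2, h3,
    hf.mul_eq]
  simp
  module

/-- Compressing the weighted flip by the matrix units `f` isolates each matrix unit `e a b`, with a
coefficient which does not vanish. -/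
theorem exists_smul_eq_sum_weightedFlip (hf : IsMatrixUnits f)
    (hef : ∀ a b c d, Commute (e a b) (f c d)) {x y : ℂ} (hx : x ≠ 0) (hy : y ≠ 0)
    (a b : Fin 2) :
    ∃ r : ℂ, r ≠ 0 ∧ r • e a b = ∑ c, f c b * weightedFlip e f x y * f a c := by
  have h1 : ∀ a b c d z, f a b * (e c d * z) = e c d * (f a b * z) := fun a b c d z => by
    rw [← mul_assoc, ← (hef c d a b).eq, mul_assoc]
  have key : ∀ r : ℂ, r • e a b = ∑ c, r • (e a b * f c c) := fun r => by
    rw [← Finset.smul_sum, ← Finset.mul_sum, hf.sum_diag, mul_one]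
  fin_cases a <;> fin_cases b
  · refine ⟨x * y, mul_ne_zero hx hy, (key _).trans (Finset.sum_congr rfl fun c _ => ?_)⟩
    simp [weightedFlip, mul_add, add_mul, mul_assoc, h1, hf.mul_eq]
  · refine ⟨x ^ 2, pow_ne_zero 2 hx, (key _).trans (Finset.sum_congr rfl fun c _ => ?_)⟩
    simp [weightedFlip, mul_add, add_mul, mul_assoc, h1, hf.mul_eq]
  · refine ⟨y ^ 2, pow_ne_zero 2 hy, (key _).trans (Finset.sum_congr rfl fun c _ => ?_)⟩
    simp [weightedFlip, mul_add, add_mul, mul_assoc, h1, hf.mul_eq]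
  · refine ⟨x * y, mul_ne_zero hx hy, (key _).trans (Finset.sum_congr rfl fun c _ => ?_)⟩
    simp [weightedFlip, mul_add, add_mul, mul_assoc, h1, hf.mul_eq]

/-- If the range of `p` is invariant under the weighted flip and `p` commutes with the matrix units
`f`, then the range of `p` is invariant under the matrix units `e`. -/
theorem mul_mul_eq_of_weightedFlip (hf : IsMatrixUnits f)
    (hef : ∀ a b c d, Commute (e a b) (f c d)) {x y : ℂ} (hx : x ≠ 0) (hy : y ≠ 0) {p : B}
    (hpf : ∀ a b, Commute p (f a b))
    (hp : p * weightedFlip e f x y * p = weightedFlip e f x y * p) (a b : Fin 2) :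
    p * e a b * p = e a b * p := by
  obtain ⟨r, hr, h⟩ := exists_smul_eq_sum_weightedFlip hf hef hx hy a b
  have h1 : p * (r • e a b) * p = r • e a b * p := by
    rw [h, Finset.mul_sum, Finset.sum_mul, Finset.sum_mul]
    refine Finset.sum_congr rfl fun c _ => ?_
    calc p * (f c b * weightedFlip e f x y * f a c) * p
        = (p * f c b) * weightedFlip e f x y * (f a c * p) := by simp only [mul_assoc]
      _ = f c b * (p * weightedFlip e f x y * p) * f a c := by
        rw [(hpf c b).eq, ← (hpf a c).eq]
        simp only [mul_assoc]
      _ = f c b * weightedFlip e f x y * (p * f a c) := by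
        rw [hp]
        simp only [mul_assoc]
      _ = f c b * weightedFlip e f x y * f a c * p := by
        rw [(hpf a c).eq]
        simp only [mul_assoc]
  rw [mul_smul_comm, smul_mul_assoc, smul_mul_assoc] at h1
  exact smul_right_injective B hr h1

end Flip

/-- If the range of a self-adjoint `p` is invariant under both `s` and `star s`, then `p` commutes
with `s`. -/
theorem commute_of_mul_mul_eq {B : Type*} [Ring B] [StarRing B] {p s : B} (hp : star p = p)
    (h : p * s * p = s * p) (h' : p * star s * p = star s * p) : Commute p s := by
  have h1 : p * s * p = p * s := by
    have := congrArg star h'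
    simpa only [star_mul, star_star, hp, mul_assoc] using this
  exact h1.symm.trans h

/-! ### Elementary tensors concentrated in one factor -/

theorem emb_tensor {m d : ℕ} (x : Fin m → Matrix (Fin 2) (Fin 2) ℂ) :
    emb m (m + d) (Nat.le_add_right m d) (tensor x) = tensor (Fin.append x fun _ => 1) := by
  refine mat_ext_append fun s u t v => ?_
  rw [emb_append]
  simp only [tensor, Matrix.of_apply, Fin.prod_univ_add, Fin.append_left, Fin.append_right,
    Matrix.one_apply, Fintype.prod_ite_zero, Finset.prod_const_one, funext_iff]
  split_ifs <;> simp

namespace AlgTensor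

theorem of_emb {m n : ℕ} (h : m ≤ n) (a : Mat m) : of n (emb m n h a) = of m a :=
  DirectLimit.Module.of_f

theorem trace_mul_comm (a b : AlgTensor) : trace (a * b) = trace (b * a) := by
  obtain ⟨m, a, rfl⟩ := exists_of a
  obtain ⟨n, b, rfl⟩ := exists_of b
  rw [← of_emb (le_max_left m n) a, ← of_emb (le_max_right m n) b, ← of_mul, ← of_mul, trace_of,
    trace_of, Matrix.trace_mul_comm]

/-- The elementary tensor `1 ⊗ ⋯ ⊗ 1 ⊗ x ⊗ 1 ⊗ ⋯` with `x` in the factor number `k`. -/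
noncomputable def site (k : ℕ) (x : Matrix (Fin 2) (Fin 2) ℂ) : AlgTensor :=
  of (k + 1) (tensor (Fin.snoc (fun _ : Fin k => 1) x))

theorem site_eq {k N : ℕ} (h : k < N) (x : Matrix (Fin 2) (Fin 2) ℂ) :
    site k x = of N (tensor (Function.update 1 ⟨k, h⟩ x)) := by
  obtain ⟨d, rfl⟩ := Nat.exists_eq_add_of_le (Nat.succ_le_of_lt h)
  rw [site, ← of_emb (Nat.le_add_right (k + 1) d), emb_tensor]
  congr 2
  funext i
  refine Fin.addCases (fun i => ?_) (fun i => ?_) i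
  · rw [Fin.append_left]
    refine Fin.lastCases ?_ (fun i => ?_) i
    · rw [Fin.snoc_last]
      exact (Function.update_self (⟨k, h⟩ : Fin (k + 1 + d)) x
        (1 : Fin (k + 1 + d) → Matrix (Fin 2) (Fin 2) ℂ)).symm
    · rw [Fin.snoc_castSucc, Function.update_of_ne]
      · rfl
      · exact fun hi => i.2.ne (congrArg Fin.val hi)
  · rw [Fin.append_right, Function.update_of_ne]
    · rfl
    · intro hi
      have := congrArg Fin.val hi
      simp at this
      omega

theorem site_mul (k : ℕ) (x y : Matrix (Fin 2) (Fin 2) ℂ) :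
    site k x * site k y = site k (x * y) := by
  rw [site, site, site, ← of_mul, tensor_mul]
  congr 2
  funext i
  refine Fin.lastCases ?_ (fun i => ?_) i <;> simp

theorem site_one (k : ℕ) : site k 1 = 1 := by
  rw [site_eq k.lt_succ_self, ← of_one (k + 1), ← tensor_one]
  congr 2
  exact Function.update_eq_self (f := (1 : Fin (k + 1) → Matrix (Fin 2) (Fin 2) ℂ)) _

theorem site_star (k : ℕ) (x : Matrix (Fin 2) (Fin 2) ℂ) : star (site k x) = site k (star x) := by
  rw [site, site, ← of_star, tensor_star]
  congr 2
  funext i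
  refine Fin.lastCases ?_ (fun i => ?_) i <;> simp

theorem site_add (k : ℕ) (x y : Matrix (Fin 2) (Fin 2) ℂ) :
    site k (x + y) = site k x + site k y := by
  rw [site, site, site, ← map_add]
  congr 1
  ext s t
  simp [tensor, Fin.prod_univ_castSucc, mul_add]

theorem site_zero (k : ℕ) : site k 0 = 0 := by
  simpa using site_add k 0 0

theorem site_commute {j k : ℕ} (h : j ≠ k) (x y : Matrix (Fin 2) (Fin 2) ℂ) :
    Commute (site j x) (site k y) := by
  rw [site_eq (N := j + k + 1) (by omega), site_eq (N := j + k + 1) (k := k) (by omega),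
    commute_iff_eq, ← of_mul, ← of_mul, tensor_mul, tensor_mul]
  congr 2
  funext i
  simp only [Pi.mul_apply, Function.update_apply, Fin.ext_iff, Pi.one_apply]
  split_ifs with h1 h2
  · exact absurd (h1.symm.trans h2) h
  all_goals simp

theorem matrixUnits_site (k : ℕ) :
    IsMatrixUnits fun a b => site k (Matrix.single a b 1) where
  mul_eq a b c d := by
    rw [site_mul]
    split_ifs with h
    · subst h; simp
    · rw [Matrix.single_mul_single_of_ne _ _ _ _ h, site_zero]
  sum_diag := by
    rw [Fin.sum_univ_two, ← site_add, ← site_one k]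
    congr 1
    ext i j
    fin_cases i <;> fin_cases j <;> simp
  star_eq a b := by
    rw [site_star]
    simp [Matrix.star_eq_conjTranspose]

/-- A subring containing all elementary tensors concentrated in one factor contains all elementary
tensors. -/
theorem of_tensor_mem (S : Subring AlgTensor) (hS : ∀ k x, site k x ∈ S) {n : ℕ}
    (x : Fin n → Matrix (Fin 2) (Fin 2) ℂ) : of n (tensor x) ∈ S := by
  have key : ∀ t : Finset (Fin n), of n (tensor fun i => if i ∈ t then x i else 1) ∈ S := by
    intro t
    induction t using Finset.induction_on with
    | empty =>
      have h : of n (tensor fun i => if i ∈ (∅ : Finset (Fin n)) then x i else 1) = 1 := by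
        rw [← of_one n, ← tensor_one]
        simp [Pi.one_def]
      rw [h]
      exact S.one_mem
    | insert k t hk ih =>
      have h : of n (tensor fun i => if i ∈ insert k t then x i else 1)
          = site k (x k) * of n (tensor fun i => if i ∈ t then x i else 1) := by
        rw [site_eq k.2, ← of_mul, tensor_mul]
        congr 2
        funext i
        by_cases hi : i = k
        · subst hi; simp [hk]
        · simp [hi]
      rw [h]
      exact S.mul_mem (hS _ _) ih
  simpa using key Finset.univ

/-- The matrix units of all the factors generate the algebraic tensor product. -/
theorem mem_of_matrixUnits_mem (S : Subalgebra ℂ AlgTensor)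
    (hS : ∀ k a b, site k (Matrix.single a b 1) ∈ S) (z : AlgTensor) : z ∈ S := by
  have hsmul : ∀ k (r : ℂ) x, site k (r • x) = r • site k x := fun k r x => by
    rw [site, site, ← map_smul]
    congr 1
    ext s t
    simp [tensor, Fin.prod_univ_castSucc, mul_left_comm]
  have hsite : ∀ k x, site k x ∈ S := fun k x => by
    have h : x = ∑ a, ∑ b, x a b • Matrix.single a b 1 := by
      simpa using Matrix.matrix_eq_sum_single x
    rw [h]
    simp only [Fin.sum_univ_two, site_add, hsmul]
    exact add_mem (add_mem (S.smul_mem (hS _ _ _) _) (S.smul_mem (hS _ _ _) _))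
      (add_mem (S.smul_mem (hS _ _ _) _) (S.smul_mem (hS _ _ _) _))
  obtain ⟨n, a, rfl⟩ := exists_of z
  have hsingle : ∀ s t, of n (Matrix.single s t 1) ∈ S := fun s t => by
    have h : (Matrix.single s t 1 : Mat n) = tensor fun k => Matrix.single (s k) (t k) 1 := by
      ext u v
      simp only [tensor, Matrix.of_apply, Matrix.single_apply, Fintype.prod_ite_zero,
        Finset.prod_const_one, funext_iff, forall_and]
    rw [h]
    exact of_tensor_mem S.toSubring hsite _
  have h : a = ∑ s, ∑ t, a s t • Matrix.single s t 1 := by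
    simpa using Matrix.matrix_eq_sum_single a
  rw [h]
  simp only [map_sum, map_smul]
  exact sum_mem fun s _ => sum_mem fun t _ => S.smul_mem (hsingle s t) _

/-- A linear functional on `⨂ M₂(ℂ)` with the trace property is a multiple of `τ`. -/
theorem eq_smul_trace (f : AlgTensor →ₗ[ℂ] ℂ) (hf : ∀ a b, f (a * b) = f (b * a))
    (z : AlgTensor) : f z = f 1 * trace z := by
  obtain ⟨n, x, rfl⟩ := exists_of z
  -- The identity `∑ e t s * x * e s t = tr x • 1`, summed over all matrix units.
  have h1 : ∑ s, ∑ t, Matrix.single t s (1 : ℂ) * x * Matrix.single s t 1 = x.trace • 1 := by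
    ext u v
    simp only [Matrix.sum_apply, Matrix.single_mul_mul_single, Matrix.smul_apply]
    simp [Matrix.single_apply, Matrix.one_apply, Matrix.trace, ite_and]
  have h2 : f (of n (∑ s, ∑ t, Matrix.single t s (1 : ℂ) * x * Matrix.single s t 1))
      = 2 ^ n * f (of n x) := by
    have h3 : ∀ s t : Fin n → Fin 2,
        f (of n (Matrix.single t s (1 : ℂ) * x * Matrix.single s t 1))
          = f (of n (Matrix.single s s 1 * x)) := fun s t => by
      rw [of_mul, hf, ← of_mul, ← mul_assoc]
      simp
    simp only [map_sum, h3, Finset.sum_const]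
    rw [← Finset.smul_sum, ← map_sum, ← map_sum, ← Finset.sum_mul, Matrix.sum_single_one]
    simp
  rw [h1, map_smul, map_smul, of_one, smul_eq_mul] at h2
  rw [trace_of]
  field_simp
  rw [mul_comm, ← h2, mul_comm]

end AlgTensor

/-! ### The representation by left multiplication -/

theorem clm_ext_coe {S T : LTwo →L[ℂ] LTwo} (h : ∀ a : AlgTensor, S a = T a) : S = T := by
  ext x
  induction x using UniformSpace.Completion.induction_on with
  | hp => exact isClosed_eq (by fun_prop) (by fun_prop)
  | ih a => exact h a

theorem leftRep_mul (a b : AlgTensor) : leftRep (a * b) = leftRep a * leftRep b :=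
  clm_ext_coe fun x => by
    simp only [mul_apply_eq_comp, leftRep_coe, mul_assoc]

theorem leftRep_add (a b : AlgTensor) : leftRep (a + b) = leftRep a + leftRep b :=
  clm_ext_coe fun x => by
    simp only [add_apply, leftRep_coe, add_mul, UniformSpace.Completion.coe_add]

theorem leftRep_smul (r : ℂ) (a : AlgTensor) : leftRep (r • a) = r • leftRep a :=
  clm_ext_coe fun x => by
    simp only [smul_apply, leftRep_coe, smul_mul_assoc,
      UniformSpace.Completion.coe_smul]

theorem leftRep_one : leftRep 1 = 1 :=
  clm_ext_coe fun x => by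
    simp only [leftRep_coe, one_mul, one_apply_eq_self]

theorem leftRep_zero : leftRep 0 = 0 := by
  simpa using leftRep_smul 0 0

theorem leftRep_star (a : AlgTensor) : leftRep (star a) = star (leftRep a) := by
  rw [ContinuousLinearMap.star_eq_adjoint, ContinuousLinearMap.eq_adjoint_iff]
  intro x y
  induction x, y using UniformSpace.Completion.induction_on₂ with
  | hp => exact isClosed_eq (by fun_prop) (by fun_prop)
  | ih x y =>
    rw [leftRep_coe, leftRep_coe, UniformSpace.Completion.inner_coe,
      UniformSpace.Completion.inner_coe, AlgTensor.inner_def, AlgTensor.inner_def]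
    simp [mul_assoc]

/-- The elements of `⨂ M₂(ℂ)` whose left multiplication commutes with `p`. -/
def leftCommutant (p : LTwo →L[ℂ] LTwo) : Subalgebra ℂ AlgTensor where
  carrier := {a | Commute p (leftRep a)}
  mul_mem' {a b} ha hb := by
    change Commute p (leftRep (a * b))
    rw [leftRep_mul]
    exact ha.mul_right hb
  add_mem' {a b} ha hb := by
    change Commute p (leftRep (a + b))
    rw [leftRep_add]
    exact ha.add_right hb
  algebraMap_mem' r := by
    change Commute p (leftRep (algebraMap ℂ AlgTensor r))
    rw [Algebra.algebraMap_eq_smul_one, leftRep_smul, leftRep_one]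
    exact (Commute.one_right p).smul_right r

/-- Elements of `R` commute with right multiplications; this is that relation in weak form, with the
right multiplication moved to the other side of the inner product. -/
theorem inner_coe_apply_coe_of_mem {T : LTwo →L[ℂ] LTwo} (hT : T ∈ hyperfinite)
    (a b : AlgTensor) :
    ⟪(b : LTwo), T a⟫_ℂ = ⟪((b * star a : AlgTensor) : LTwo), T (1 : AlgTensor)⟫_ℂ := by
  have hcont : ∀ x y : LTwo,
      Continuous fun S : LTwo →WOT[ℂ] LTwo => ⟪x, S y⟫_ℂ := fun x y =>
    ContinuousLinearMapWOT.continuous_dual_apply y (innerSL ℂ x)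
  have hclosed : IsClosed {S : LTwo →WOT[ℂ] LTwo |
      ⟪(b : LTwo), S a⟫_ℂ = ⟪((b * star a : AlgTensor) : LTwo), S (1 : AlgTensor)⟫_ℂ} :=
    isClosed_eq (hcont _ _) (hcont _ _)
  refine closure_minimal (t := {S : LTwo →WOT[ℂ] LTwo |
      ⟪(b : LTwo), S a⟫_ℂ = ⟪((b * star a : AlgTensor) : LTwo), S (1 : AlgTensor)⟫_ℂ})
    ?_ hclosed hT
  rintro _ ⟨x, rfl⟩
  change ⟪(b : LTwo), leftRep x a⟫_ℂ
    = ⟪((b * star a : AlgTensor) : LTwo), leftRep x (1 : AlgTensor)⟫_ℂ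
  rw [leftRep_coe, leftRep_coe, UniformSpace.Completion.inner_coe,
    UniformSpace.Completion.inner_coe, AlgTensor.inner_def, AlgTensor.inner_def, mul_one, star_mul,
    star_star, mul_assoc, AlgTensor.trace_mul_comm a, mul_assoc]

/-- `R` is a factor: its elements which commute with all left multiplications are scalars. -/
theorem exists_eq_smul_one {T : LTwo →L[ℂ] LTwo} (hT : T ∈ hyperfinite)
    (h : ∀ a, Commute T (leftRep a)) : ∃ r : ℂ, T = r • 1 := by
  set ξ : LTwo := T (1 : AlgTensor) with hξ
  have hTa : ∀ a : AlgTensor, T a = leftRep a ξ := fun a => by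
    have := DFunLike.congr_fun (h a).eq ((1 : AlgTensor) : LTwo)
    simpa [mul_apply_eq_comp, leftRep_coe] using this
  -- `f b = ⟪ξ, b⟫` has the trace property because `ξ` commutes with `⨂ M₂(ℂ)`.
  let f : AlgTensor →ₗ[ℂ] ℂ :=
    { toFun := fun b => ⟪ξ, (b : LTwo)⟫_ℂ
      map_add' := fun a b => by rw [UniformSpace.Completion.coe_add, inner_add_right]
      map_smul' := fun r a => by
        rw [UniformSpace.Completion.coe_smul, inner_smul_right]; rfl }
  have hf : ∀ a b, f (a * b) = f (b * a) := fun a b => by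
    have h1 := inner_coe_apply_coe_of_mem hT (star a) b
    rw [hTa, star_star, ← hξ, leftRep_star, ContinuousLinearMap.star_eq_adjoint,
      ContinuousLinearMap.adjoint_inner_right, leftRep_coe] at h1
    change ⟪ξ, ((a * b : AlgTensor) : LTwo)⟫_ℂ = ⟪ξ, ((b * a : AlgTensor) : LTwo)⟫_ℂ
    rw [← inner_conj_symm, h1, inner_conj_symm]
  have hξ1 : ξ = star (f 1) • ((1 : AlgTensor) : LTwo) := by
    refine ext_inner_right ℂ fun x => ?_
    induction x using UniformSpace.Completion.induction_on with
    | hp => exact isClosed_eq (by fun_prop) (by fun_prop)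
    | ih b =>
      rw [inner_smul_left, UniformSpace.Completion.inner_coe, AlgTensor.inner_def, star_one, one_mul]
      rw [starRingEnd_apply, star_star]
      exact AlgTensor.eq_smul_trace f hf b
  refine ⟨star (f 1), clm_ext_coe fun a => ?_⟩
  rw [hTa, hξ1, map_smul, leftRep_coe, mul_one]
  rfl

/-! ### Matrix units acting on `L²` -/

/-- The matrix unit `(a, b)` of the factor number `k`, acting on `L²` by left multiplication. -/
noncomputable def siteUnit (k : ℕ) (a b : Fin 2) : LTwo →L[ℂ] LTwo :=
  leftRep (AlgTensor.site k (Matrix.single a b 1))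

theorem matrixUnits_siteUnit (k : ℕ) : IsMatrixUnits (siteUnit k) where
  mul_eq a b c d := by
    have h := (AlgTensor.matrixUnits_site k).mul_eq a b c d
    rw [siteUnit, siteUnit, ← leftRep_mul, h]
    split_ifs
    · rfl
    · exact leftRep_zero
  sum_diag := by
    have h := (AlgTensor.matrixUnits_site k).sum_diag
    rw [Fin.sum_univ_two] at h ⊢
    rw [siteUnit, siteUnit, ← leftRep_add, h, leftRep_one]
  star_eq a b := by
    rw [siteUnit, ← leftRep_star]
    exact congrArg leftRep ((AlgTensor.matrixUnits_site k).star_eq a b)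

theorem siteUnit_commute {j k : ℕ} (h : j ≠ k) (a b c d : Fin 2) :
    Commute (siteUnit j a b) (siteUnit k c d) := by
  rw [commute_iff_eq, siteUnit, siteUnit, ← leftRep_mul, ← leftRep_mul,
    (AlgTensor.site_commute h _ _).eq]

theorem Vop_eq_siteUnit (k : ℕ) : Vop k = siteUnit k 0 1 := by
  have h : V = Matrix.single 0 1 1 := by
    ext i j
    fin_cases i <;> fin_cases j <;> simp [V]
  rw [Vop, h]
  rfl

theorem siteUnit_commute_partialOp (c : ℕ → ℂ) {n k : ℕ} (h : n ≤ k) (a b : Fin 2) :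
    Commute (siteUnit k a b) (partialOp c n) := by
  refine Commute.sum_right _ _ _ fun j hj => Commute.smul_right ?_ _
  rw [Vop_eq_siteUnit]
  exact siteUnit_commute (by have := Finset.mem_range.1 hj; omega) _ _ _ _

/-- The flip of the factors `i` and `j`, weighted by the coefficients of `Vᵢ` and `Vⱼ` in `A`,
commutes with `A`. -/
theorem weightedFlip_commute_fullOp {c : ℕ → ℂ} (hc : Summable fun k => ‖c k‖) {i j : ℕ}
    (hij : i ≠ j) :
    Commute (weightedFlip (siteUnit i) (siteUnit j) (c i) (c j)) (fullOp c) := by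
  set F := weightedFlip (siteUnit i) (siteUnit j) (c i) (c j) with hF
  have hs := summable_smul_Vop hc
  have h1 : Commute F (c i • Vop i + c j • Vop j) := by
    rw [Vop_eq_siteUnit, Vop_eq_siteUnit]
    exact weightedFlip_commute (matrixUnits_siteUnit i) (matrixUnits_siteUnit j)
      (fun _ _ _ _ => siteUnit_commute hij _ _ _ _) _ _
  have h2 : ∀ k ∉ ({i, j} : Finset ℕ), F * (c k • Vop k) - c k • Vop k * F = 0 := by
    intro k hk
    simp only [Finset.mem_insert, Finset.mem_singleton, not_or] at hk
    have hi : ∀ a b, Commute (siteUnit i a b) (Vop k) := fun a b => by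
      rw [Vop_eq_siteUnit]; exact siteUnit_commute (Ne.symm hk.1) _ _ _ _
    have hj : ∀ a b, Commute (siteUnit j a b) (Vop k) := fun a b => by
      rw [Vop_eq_siteUnit]; exact siteUnit_commute (Ne.symm hk.2) _ _ _ _
    have h3 : ∀ (r : ℂ) a b a' b', Commute (r • (siteUnit i a b * siteUnit j a' b')) (Vop k) :=
      fun r a b a' b' => ((hi a b).mul_left (hj a' b')).smul_left r
    have h4 : Commute F (Vop k) :=
      (((h3 _ _ _ _ _).add_left (h3 _ _ _ _ _)).add_left (h3 _ _ _ _ _)).add_left (h3 _ _ _ _ _)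
    exact sub_eq_zero.2 (h4.smul_right (c k)).eq
  rw [commute_iff_eq, ← sub_eq_zero, fullOp, ← hs.tsum_mul_left, ← hs.tsum_mul_right,
    ← (hs.mul_left F).tsum_sub (hs.mul_right F), tsum_eq_sum h2, Finset.sum_pair hij,
    sub_add_sub_comm, ← mul_add, ← add_mul, h1.eq, sub_self]

end HyperfiniteFactor

theorem mainTheorem6 (c : ℕ → ℂ) (hc : Summable fun k => ‖c k‖) (hc0 : ∀ k, c k ≠ 0) (n : ℕ)
    (p : HyperfiniteFactor.LTwo →L[ℂ] HyperfiniteFactor.LTwo)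
    (hpR : p ∈ HyperfiniteFactor.hyperfinite) (hp : IsStarProjection p)
    (hp0 : p ≠ 0) (hp1 : p ≠ 1)
    (hinv : HyperfiniteFactor.IsHyperinvariant p (HyperfiniteFactor.partialOp c n)) :
    ¬ HyperfiniteFactor.IsHyperinvariant p (HyperfiniteFactor.fullOp c) := by
  intro hfull
  have hpstar : star p = p := hp.isSelfAdjoint
  -- For `k ≥ n` the matrix units of the factor `k` and their adjoints commute with `Aₙ`.
  have hlarge : ∀ k, n ≤ k → ∀ a b, Commute p (HyperfiniteFactor.siteUnit k a b) := by
    intro k hk a b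
    refine HyperfiniteFactor.commute_of_mul_mul_eq hpstar
      (hinv _ (HyperfiniteFactor.siteUnit_commute_partialOp c hk a b)) ?_
    rw [(HyperfiniteFactor.matrixUnits_siteUnit k).star_eq]
    exact hinv _ (HyperfiniteFactor.siteUnit_commute_partialOp c hk b a)
  -- For `i < n` the flip of the factors `i` and `n` exchanges the two sides of the cut at `n`.
  have hsmall : ∀ i, i < n → ∀ a b, Commute p (HyperfiniteFactor.siteUnit i a b) := by
    intro i hi
    have key : ∀ a b, p * HyperfiniteFactor.siteUnit i a b * p
        = HyperfiniteFactor.siteUnit i a b * p :=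
      HyperfiniteFactor.mul_mul_eq_of_weightedFlip (HyperfiniteFactor.matrixUnits_siteUnit n)
        (fun _ _ _ _ => HyperfiniteFactor.siteUnit_commute hi.ne _ _ _ _) (hc0 i) (hc0 n)
        (hlarge n le_rfl) (hfull _ (HyperfiniteFactor.weightedFlip_commute_fullOp hc hi.ne))
    intro a b
    refine HyperfiniteFactor.commute_of_mul_mul_eq hpstar (key a b) ?_
    rw [(HyperfiniteFactor.matrixUnits_siteUnit i).star_eq]
    exact key b a
  have hall : ∀ z, Commute p (HyperfiniteFactor.leftRep z) :=
    HyperfiniteFactor.AlgTensor.mem_of_matrixUnits_mem (HyperfiniteFactor.leftCommutant p)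
      fun k a b => (lt_or_ge k n).elim (fun h => hsmall k h a b) fun h => hlarge k h a b
  obtain ⟨r, rfl⟩ := HyperfiniteFactor.exists_eq_smul_one hpR hall
  have hidem : (r * r - r) • (1 : HyperfiniteFactor.LTwo →L[ℂ] HyperfiniteFactor.LTwo) = 0 := by
    have h := hp.isIdempotentElem.eq
    rw [smul_mul_smul_comm, one_mul] at h
    rw [sub_smul, h, sub_self]
  have h1 : (1 : HyperfiniteFactor.LTwo →L[ℂ] HyperfiniteFactor.LTwo) ≠ 0 := fun h =>
    hp0 (by rw [h, smul_zero])
  rcases mul_eq_zero.1 (show r * (r - 1) = 0 by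
    linear_combination (smul_eq_zero.1 hidem).resolve_right h1) with h | h
  · exact hp0 (by rw [h, zero_smul])
  · exact hp1 (by rw [sub_eq_zero.1 h, one_smul])
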